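/- Let $R$ be a unital ring and let $M$ be a right $R$-module such that $\operatorname{Ext}^1_R(M,-)$ commutes with direct sums of copies of $R$, i.e. for every set $I$ the canonical homomorphism $$\bigoplus_{i\in I}\operatorname{Ext}^1_R(M,R)\longrightarrow \operatorname{Ext}^1_R\bigl(M,R^{(I)}\bigr)$$ induced by the canonical injections $R\to R^{(I)}$ is an isomorphism. Suppose that there is an exact sequence of right $R$-modules $$P_2\xrightarrow{\alpha_2}P_1\xrightarrow{\alpha_1}P_0\xrightarrow{\alpha_0}M\to 0$$ with $P_0,P_1,P_2$ projective whose second syzygy $\operatorname{Im}(\alpha_2)$ is finitely generated. Then there is an exact sequence of right $R$-modules $$P_2\xrightarrow{\alpha_2'}P_1'\xrightarrow{\alpha_1'}P_0'\xrightarrow{\alpha_0'}M\to 0$$ with $P_0',P_1'$ projective, $P_1'$ finitely generated, and with the same second syzygy: there is an isomorphism $e:\operatorname{Im}(\alpha_2)\to\operatorname{Im}(\alpha_2')$ such that $e(\alpha_2(x))=\alpha_2'(x)$ for all $x\in P_2$. -/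

import Mathlib

open CategoryTheory

universe u

/-- The canonical homomorphism `⨁_{i ∈ I} Ext^n_S(M, N) ⟶ Ext^n_S(M, N^(I))`, which on the
`i`-th summand is `Ext^n_S(M, u_i)` for the canonical injection `u_i : N → N^(I)`.
Direct sums of copies of one object are written as finitely supported functions on `I`. -/
noncomputable def extSumComparison (S : Type u) [Ring S] (n : ℕ)
    (M : Type u) [AddCommGroup M] [Module S M]
    (N : Type u) [AddCommGroup N] [Module S N] (I : Type u) :
    (I →₀ Abelian.Ext (ModuleCat.of S M) (ModuleCat.of S N) n) →+
      Abelian.Ext (ModuleCat.of S M) (ModuleCat.of S (I →₀ N)) n :=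
  Finsupp.liftAddHom fun i =>
    (Abelian.Ext.mk₀ (ModuleCat.ofHom (Finsupp.lsingle i : N →ₗ[S] (I →₀ N)))).postcomp
      (ModuleCat.of S M) (add_zero n)

/-- `Ext^n_S(M, -)` commutes with direct sums of copies of `N`: for every index set `I`, the
canonical homomorphism `⨁_{i ∈ I} Ext^n_S(M, N) ⟶ Ext^n_S(M, N^(I))` is an isomorphism. -/
def ExtCommutesWithSumsOf (S : Type u) [Ring S] (n : ℕ)
    (M : Type u) [AddCommGroup M] [Module S M]
    (N : Type u) [AddCommGroup N] [Module S N] : Prop :=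
  ∀ I : Type u, Function.Bijective (extSumComparison S n M N I)

/-- `P₂ → P₁ → P₀ → M → 0` is (the beginning of) a projective resolution of `M`. -/
structure IsProjRes {S : Type u} [Ring S] {P₂ P₁ P₀ M : Type u}
    [AddCommGroup P₂] [Module S P₂] [AddCommGroup P₁] [Module S P₁]
    [AddCommGroup P₀] [Module S P₀] [AddCommGroup M] [Module S M]
    (α₂ : P₂ →ₗ[S] P₁) (α₁ : P₁ →ₗ[S] P₀) (α₀ : P₀ →ₗ[S] M) : Prop where
  projective₂ : Module.Projective S P₂
  projective₁ : Module.Projective S P₁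
  projective₀ : Module.Projective S P₀
  exact₁ : Function.Exact α₂ α₁
  exact₀ : Function.Exact α₁ α₀
  surjective : Function.Surjective α₀

/-! After adding a complement to `P₁` and `P₀`, the middle term is free, say `R^(I)`, with map `a`
to `P`. The second syzygy `K = ker a` is finitely generated, so it lives in finitely many
coordinates, and erasing these factors through the first syzygy `L = R^(I)/K`. Pushing the class of
`0 → L → P → M → 0` along `L → R^(I)` gives an element of `Ext¹(M, R^(I))`. By hypothesis it comes
from a finite sum of classes, so erasing finitely many more coordinates kills it, and the erased map
extends to `g` on `P`. Then `g ∘ a` erases a finite set `T`, so the coordinates outside `T` split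
off from both `R^(I)` and `P`. What remains is `R^T → ker g → M`, still with kernel `K`. -/

namespace Finsupp

variable {S : Type*} [Ring S] {I N : Type*} [AddCommGroup N] [Module S N]

open Classical in
/-- The endomorphism of `I →₀ N` that sets all coordinates in `T` to zero. -/
noncomputable def eraseOn (S : Type*) [Ring S] {I : Type*} (N : Type*) [AddCommGroup N]
    [Module S N] (T : Finset I) : (I →₀ N) →ₗ[S] (I →₀ N) :=
  (supported N S ((T : Set I)ᶜ)).subtype ∘ₗ restrictDom N S ((T : Set I)ᶜ)

lemma eraseOn_apply_of_mem {T : Finset I} {i : I} (hi : i ∈ T) (x : I →₀ N) :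
    eraseOn S N T x i = 0 := by
  simp [eraseOn, restrictDom_apply, hi]

lemma eraseOn_apply_of_notMem {T : Finset I} {i : I} (hi : i ∉ T) (x : I →₀ N) :
    eraseOn S N T x i = x i := by
  simp [eraseOn, restrictDom_apply, hi]

lemma eraseOn_eq_zero_iff {T : Finset I} {x : I →₀ N} :
    eraseOn S N T x = 0 ↔ x ∈ supported N S (T : Set I) := by
  rw [mem_supported', Finsupp.ext_iff]
  refine forall_congr' fun i => ?_
  by_cases hi : i ∈ T
  · simp [eraseOn_apply_of_mem hi, hi]
  · simp [eraseOn_apply_of_notMem hi, hi]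

lemma eraseOn_eraseOn_of_subset {T U : Finset I} (h : T ⊆ U) (x : I →₀ N) :
    eraseOn S N U (eraseOn S N T x) = eraseOn S N U x := by
  ext i
  by_cases hi : i ∈ U
  · simp [eraseOn_apply_of_mem hi]
  · simp [eraseOn_apply_of_notMem hi, eraseOn_apply_of_notMem fun hT => hi (h hT)]

lemma eraseOn_comp_lsingle {T : Finset I} {i : I} (hi : i ∈ T) :
    eraseOn S N T ∘ₗ lsingle i = 0 := by
  ext1 x
  refine (eraseOn_eq_zero_iff (S := S)).2 ?_
  exact single_mem_supported S x hi

lemma exists_finset_le_supported {K : Submodule S (I →₀ N)} (hK : K.FG) :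
    ∃ T : Finset I, K ≤ supported N S (T : Set I) := by
  classical
  obtain ⟨s, rfl⟩ := hK
  refine ⟨s.biUnion fun x => x.support, Submodule.span_le.2 fun x hx => ?_⟩
  rw [SetLike.mem_coe, mem_supported]
  exact_mod_cast Finset.subset_biUnion_of_mem (fun x : I →₀ N => x.support) hx

end Finsupp

open Finsupp

section

variable {S : Type u} [Ring S] {M N : Type u} [AddCommGroup M] [Module S M]
  [AddCommGroup N] [Module S N]

/-- A class coming from the comparison map is killed by erasing finitely many
coordinates. -/
lemma extSumComparison_comp_eraseOn_eq_zero {I : Type u} {n : ℕ}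
    (ξ : I →₀ Abelian.Ext (ModuleCat.of S M) (ModuleCat.of S N) n) (T : Finset I)
    (hT : ξ.support ⊆ T) :
    (extSumComparison S n M N I ξ).comp
      (Abelian.Ext.mk₀ (ModuleCat.ofHom (eraseOn S N T))) (add_zero n) = 0 := by
  have : ∀ i ∈ ξ.support, ((ξ i).comp (Abelian.Ext.mk₀
      (ModuleCat.ofHom (lsingle i : N →ₗ[S] (I →₀ N)))) (add_zero n)).comp
      (Abelian.Ext.mk₀ (ModuleCat.ofHom (eraseOn S N T))) (add_zero n) = 0 := by
    intro i hi
    rw [Abelian.Ext.comp_assoc_of_third_deg_zero, Abelian.Ext.mk₀_comp_mk₀,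
      ← ModuleCat.ofHom_comp, eraseOn_comp_lsingle (hT hi)]
    have : ModuleCat.ofHom (0 : N →ₗ[S] (I →₀ N)) = 0 := rfl
    rw [this, Abelian.Ext.mk₀_zero, Abelian.Ext.comp_zero]
  have hsum : extSumComparison S n M N I ξ = ∑ i ∈ ξ.support, (ξ i).comp (Abelian.Ext.mk₀
      (ModuleCat.ofHom (lsingle i : N →ₗ[S] (I →₀ N)))) (add_zero n) := rfl
  rw [hsum]
  refine (map_sum ((Abelian.Ext.mk₀ (ModuleCat.ofHom (eraseOn S N T))).postcomp
    (ModuleCat.of S M) (add_zero n)) _ _).trans (Finset.sum_eq_zero this)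

/-- If `Ext¹(M, -)` commutes with sums of copies of `N`, a map from the first syzygy of `M` to such
a sum extends to the ambient module after erasing finitely many coordinates. -/
lemma ExtCommutesWithSumsOf.exists_extension (hExt : ExtCommutesWithSumsOf S 1 M N)
    {P L I : Type u} [AddCommGroup P] [Module S P] [AddCommGroup L] [Module S L]
    {f : L →ₗ[S] P} {p : P →ₗ[S] M} (hf : Function.Injective f) (hfp : Function.Exact f p)
    (hp : Function.Surjective p) (q : L →ₗ[S] (I →₀ N)) :
    ∃ T : Finset I, ∀ U : Finset I, T ⊆ U →
      ∃ g : P →ₗ[S] (I →₀ N), g ∘ₗ f = eraseOn S N U ∘ₗ q := by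
  let C : ShortComplex (ModuleCat.{u} S) :=
    ShortComplex.mk (ModuleCat.ofHom f) (ModuleCat.ofHom p) (by
      ext x
      exact hfp.apply_apply_eq_zero x)
  have hC : C.ShortExact := ModuleCat.shortComplex_shortExact C hfp hf hp
  obtain ⟨ξ, hξ⟩ := (hExt I).2
    (hC.extClass.comp (Abelian.Ext.mk₀ (ModuleCat.ofHom q)) (add_zero 1))
  refine ⟨ξ.support, fun U hU => ?_⟩
  have h0 : hC.extClass.comp
      (Abelian.Ext.mk₀ (ModuleCat.ofHom (eraseOn S N U ∘ₗ q))) (add_zero 1) = 0 := by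
    have := extSumComparison_comp_eraseOn_eq_zero ξ U hU
    rw [hξ, Abelian.Ext.comp_assoc_of_third_deg_zero, Abelian.Ext.mk₀_comp_mk₀] at this
    exact this
  -- The class is the image of the erased map under the connecting homomorphism, so its vanishing
  -- gives the extension to `P`.
  obtain ⟨x, hx⟩ := Abelian.Ext.contravariant_sequence_exact₁ hC _ _ (add_zero 1) h0
  obtain ⟨g, rfl⟩ := (Abelian.Ext.mk₀_bijective _ _).2 x
  rw [Abelian.Ext.mk₀_comp_mk₀] at hx
  have := (Abelian.Ext.mk₀_bijective _ _).1 hx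
  exact ⟨g.hom, congrArg ModuleCat.Hom.hom this⟩

/-- If `g ∘ a` is an idempotent which `g` absorbs, then `ker g` is a direct summand. -/
lemma Module.Projective.ker_of_comp_comp_eq {P F : Type*} [AddCommGroup P] [Module S P]
    [AddCommGroup F] [Module S F] [Module.Projective S P] (a : F →ₗ[S] P) (g : P →ₗ[S] F)
    (h : ∀ x, g (a (g x)) = g x) : Module.Projective S (LinearMap.ker g) := by
  refine Module.Projective.of_split (LinearMap.ker g).subtype
    ((LinearMap.id - a ∘ₗ g).codRestrict (LinearMap.ker g) fun x => by simp [h]) ?_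
  ext x
  simp

/-- A presentation of `M` by a sum of copies of `N` with finitely generated kernel splits off all
but finitely many of these copies. -/
lemma ExtCommutesWithSumsOf.exists_truncation (hExt : ExtCommutesWithSumsOf S 1 M N)
    {P I : Type u} [AddCommGroup P] [Module S P]
    {a : (I →₀ N) →ₗ[S] P} {p : P →ₗ[S] M} (hap : Function.Exact a p)
    (hp : Function.Surjective p) (hfg : (LinearMap.ker a).FG) :
    ∃ (T : Finset I) (g : P →ₗ[S] (I →₀ N)), LinearMap.ker a ≤ supported N S (T : Set I) ∧
      (∀ x, g (a x) = eraseOn S N T x) ∧ ∀ x, g (a (g x)) = g x := by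
  classical
  obtain ⟨T₀, hT₀⟩ := exists_finset_le_supported hfg
  let f : ((I →₀ N) ⧸ LinearMap.ker a) →ₗ[S] P := (LinearMap.ker a).liftQ a le_rfl
  let q : ((I →₀ N) ⧸ LinearMap.ker a) →ₗ[S] (I →₀ N) :=
    (LinearMap.ker a).liftQ (eraseOn S N T₀) fun x hx => eraseOn_eq_zero_iff.2 (hT₀ hx)
  have hf : Function.Injective f := by
    rw [← LinearMap.ker_eq_bot]
    exact Submodule.ker_liftQ_eq_bot _ _ _ le_rfl
  have hfp : Function.Exact f p := by
    rw [LinearMap.exact_iff] at hap ⊢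
    rw [hap, Submodule.range_liftQ]
  obtain ⟨T₁, hT₁⟩ := hExt.exists_extension hf hfp hp q
  obtain ⟨g, hg⟩ := hT₁ (T₀ ∪ T₁) Finset.subset_union_right
  have hga : ∀ x, g (a x) = eraseOn S N (T₀ ∪ T₁) x := fun x => by
    rw [← eraseOn_eraseOn_of_subset (Finset.subset_union_left (s₁ := T₀) (s₂ := T₁))]
    exact LinearMap.congr_fun hg (Submodule.Quotient.mk x)
  -- Erasing once more after `g` gives a map whose values are fixed by the erasure, hence absorbed
  -- by `g ∘ a`.
  refine ⟨T₀ ∪ T₁, eraseOn S N (T₀ ∪ T₁) ∘ₗ g, hT₀.trans (supported_mono (by simp)), ?_, ?_⟩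
  · intro x
    simp [hga, eraseOn_eraseOn_of_subset (Finset.Subset.refl _)]
  · intro x
    simp [hga, eraseOn_eraseOn_of_subset (Finset.Subset.refl _)]

/-- Maps with the same source and the same kernel have isomorphic ranges, compatibly with the
maps. -/
lemma LinearMap.exists_rangeEquiv_of_ker_eq {A B C : Type*} [AddCommGroup A] [Module S A]
    [AddCommGroup B] [Module S B] [AddCommGroup C] [Module S C] (f : A →ₗ[S] B) (g : A →ₗ[S] C)
    (h : LinearMap.ker f = LinearMap.ker g) :
    ∃ e : LinearMap.range f ≃ₗ[S] LinearMap.range g,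
      ∀ x, e (f.rangeRestrict x) = g.rangeRestrict x := by
  refine ⟨f.quotKerEquivRange.symm ≪≫ₗ Submodule.quotEquivOfEq _ _ h ≪≫ₗ g.quotKerEquivRange,
    fun x => ?_⟩
  have : f.quotKerEquivRange.symm (f.rangeRestrict x) = Submodule.Quotient.mk x := by
    rw [LinearEquiv.symm_apply_eq]
    rfl
  rw [LinearEquiv.trans_apply, LinearEquiv.trans_apply, this]
  rfl

/-- The case where the middle term is a sum of copies of `N`. -/
lemma ExtCommutesWithSumsOf.exists_finite_projRes_of_finsupp
    [Module.Finite S N] [Module.Projective S N]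
    (hExt : ExtCommutesWithSumsOf S 1 M N) {P₂ P I : Type u} [AddCommGroup P₂] [Module S P₂]
    [AddCommGroup P] [Module S P] {b : P₂ →ₗ[S] (I →₀ N)} {a : (I →₀ N) →ₗ[S] P}
    {p : P →ₗ[S] M} (hP : IsProjRes b a p) (hfg : (LinearMap.range b).FG) :
    ∃ (P₀' P₁' : ModuleCat.{u} S)
      (α₂' : P₂ →ₗ[S] P₁') (α₁' : P₁' →ₗ[S] P₀') (α₀' : P₀' →ₗ[S] M),
      IsProjRes α₂' α₁' α₀' ∧ Module.Finite S P₁' ∧ LinearMap.ker α₂' = LinearMap.ker b := by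
  classical
  have hba := LinearMap.exact_iff.1 hP.exact₁
  obtain ⟨T, g, hK, hga, hgag⟩ := hExt.exists_truncation hP.exact₀ hP.surjective (hba ▸ hfg)
  have hbT : ∀ x, b x ∈ supported N S (T : Set I) := fun x =>
    hK (hba ▸ LinearMap.mem_range_self b x)
  have haT : ∀ x : supported N S (T : Set I), a x ∈ LinearMap.ker g := fun x => by
    rw [LinearMap.mem_ker, hga]
    exact eraseOn_eq_zero_iff.2 x.2
  have := hP.projective₀
  have : Module.Projective S (supported N S (T : Set I)) :=
    Module.Projective.of_equiv' ((finsuppLequivDFinsupp S).symm ≪≫ₗ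
      (supportedEquivFinsupp (M := N) (R := S) (T : Set I)).symm)
  refine ⟨ModuleCat.of S (LinearMap.ker g), ModuleCat.of S (supported N S (T : Set I)),
    b.codRestrict _ hbT, (a ∘ₗ Submodule.subtype _).codRestrict _ haT, p ∘ₗ Submodule.subtype _,
    ⟨hP.projective₂, this, Module.Projective.ker_of_comp_comp_eq a g hgag, ?_, ?_, ?_⟩, ?_, ?_⟩
  · intro y
    rw [Subtype.ext_iff]
    refine (hP.exact₁ y.1).trans ?_
    simp only [Set.mem_range]
    exact exists_congr fun x => by rw [Subtype.ext_iff]; rfl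
  · intro y
    refine (hP.exact₀ y.1).trans ⟨?_, ?_⟩
    · rintro ⟨x, hx⟩
      refine ⟨⟨x, (eraseOn_eq_zero_iff (S := S)).1 ?_⟩, Subtype.ext hx⟩
      rw [← hga, hx]
      exact y.2
    · rintro ⟨x, rfl⟩
      exact ⟨x.1, rfl⟩
  · intro m
    obtain ⟨y, rfl⟩ := hP.surjective m
    -- Project `y` to `ker g` along the image of `a ∘ g`, which `p` kills.
    refine ⟨⟨y - a (g y), ?_⟩, ?_⟩
    · rw [LinearMap.mem_ker, map_sub, hgag, sub_self]
    · change p (y - a (g y)) = p y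
      rw [map_sub, hP.exact₀.apply_apply_eq_zero, sub_zero]
  · exact Module.Finite.equiv (supportedEquivFinsupp (M := N) (R := S) (T : Set I)).symm
  · exact LinearMap.ker_codRestrict _ _ _

/-- Adding a complement, the middle term of a resolution can be replaced by any module of which it
is a direct summand. -/
lemma IsProjRes.of_split {P₂ P₁ P₀ F : Type u} [AddCommGroup P₂] [Module S P₂]
    [AddCommGroup P₁] [Module S P₁] [AddCommGroup P₀] [Module S P₀] [AddCommGroup F] [Module S F]
    [Module.Projective S F] {α₂ : P₂ →ₗ[S] P₁} {α₁ : P₁ →ₗ[S] P₀} {α₀ : P₀ →ₗ[S] M}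
    (hP : IsProjRes α₂ α₁ α₀) (i : P₁ →ₗ[S] F) (r : F →ₗ[S] P₁) (hri : ∀ x, r (i x) = x) :
    IsProjRes (i ∘ₗ α₂)
      ((α₁ ∘ₗ r).prod
        ((LinearMap.id - i ∘ₗ r).codRestrict (LinearMap.ker r) fun x => by simp [hri]))
      (α₀ ∘ₗ LinearMap.fst S P₀ (LinearMap.ker r)) := by
  have := hP.projective₀
  have : Module.Projective S (LinearMap.ker r) :=
    Module.Projective.ker_of_comp_comp_eq i r fun x => hri _
  refine ⟨hP.projective₂, inferInstance, inferInstance, ?_, ?_, ?_⟩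
  · intro x
    rw [LinearMap.prod_apply, Prod.ext_iff, Subtype.ext_iff]
    change α₁ (r x) = 0 ∧ x - i (r x) = 0 ↔ _
    rw [hP.exact₁ (r x), sub_eq_zero]
    constructor
    · rintro ⟨⟨z, hz⟩, hx⟩
      exact ⟨z, by rw [hx, ← hz]; rfl⟩
    · rintro ⟨z, rfl⟩
      simp [hri]
  · rintro ⟨y, k⟩
    refine (hP.exact₀ y).trans ⟨?_, ?_⟩
    · rintro ⟨x, rfl⟩
      have hk : r k = 0 := k.2
      -- Under `F = i(P₁) ⊕ ker r`, the new map is `α₁` on the first summand and the identity on the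
      -- second.
      exact ⟨i x + k, Prod.ext (by simp [hri, hk]) (Subtype.ext (by simp [hri, hk]))⟩
    · rintro ⟨x, hx⟩
      exact ⟨r x, congrArg Prod.fst hx⟩
  · intro m
    obtain ⟨y, rfl⟩ := hP.surjective m
    exact ⟨(y, 0), rfl⟩

/-- Keeping `N` separate from `S` allows for `R` as a module over `Rᵐᵒᵖ`, which is only isomorphic
to `Rᵐᵒᵖ`. -/
theorem ExtCommutesWithSumsOf.exists_finite_projRes (e : N ≃ₗ[S] S)
    (hExt : ExtCommutesWithSumsOf S 1 M N) {P₂ P₁ P₀ : Type u} [AddCommGroup P₂] [Module S P₂]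
    [AddCommGroup P₁] [Module S P₁] [AddCommGroup P₀] [Module S P₀]
    {α₂ : P₂ →ₗ[S] P₁} {α₁ : P₁ →ₗ[S] P₀} {α₀ : P₀ →ₗ[S] M}
    (hP : IsProjRes α₂ α₁ α₀) (hfg : (LinearMap.range α₂).FG) :
    ∃ (P₀' P₁' : ModuleCat.{u} S)
      (α₂' : P₂ →ₗ[S] P₁') (α₁' : P₁' →ₗ[S] P₀') (α₀' : P₀' →ₗ[S] M),
      IsProjRes α₂' α₁' α₀' ∧ Module.Finite S P₁' ∧
        ∃ e : LinearMap.range α₂ ≃ₗ[S] LinearMap.range α₂',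
          ∀ x : P₂, e (α₂.rangeRestrict x) = α₂'.rangeRestrict x := by
  have : Module.Finite S N := Module.Finite.equiv e.symm
  have : Module.Projective S N := Module.Projective.of_equiv' e.symm
  have : Module.Projective S (P₁ →₀ N) :=
    Module.Projective.of_equiv' (Finsupp.mapRange.linearEquiv e.symm)
  have := hP.projective₁
  -- The free cover of `P₁` on all its elements; it splits by projectivity.
  let r : (P₁ →₀ N) →ₗ[S] P₁ :=
    Finsupp.linearCombination S id ∘ₗ (Finsupp.mapRange.linearEquiv e).toLinearMap
  have hr : Function.Surjective r :=
    (Finsupp.linearCombination_id_surjective S P₁).comp (LinearEquiv.surjective _)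
  obtain ⟨i, hi⟩ := Module.projective_lifting_property r LinearMap.id hr
  have hri : ∀ x, r (i x) = x := LinearMap.congr_fun hi
  have hfg' : (LinearMap.range (i ∘ₗ α₂)).FG := by
    rw [LinearMap.range_comp]
    exact hfg.map i
  obtain ⟨P₀', P₁', α₂', α₁', α₀', hP', hfin, hker⟩ :=
    hExt.exists_finite_projRes_of_finsupp (hP.of_split i r hri) hfg'
  refine ⟨P₀', P₁', α₂', α₁', α₀', hP', hfin, LinearMap.exists_rangeEquiv_of_ker_eq _ _ ?_⟩
  rw [hker, LinearMap.ker_comp_of_ker_eq_bot]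
  exact LinearMap.ker_eq_bot.2 (Function.LeftInverse.injective hri)

end

/-- Right `R`-modules are modules over `Rᵐᵒᵖ`. The second syzygy of a resolution is the image of
`α₂`. Equality of the second syzygies of the two resolutions, both of which start from the same
`P₂`, means that the two images are identified as quotients of `P₂`. -/
theorem corollary2p10 {R : Type u} [Ring R] {M P₀ P₁ P₂ : Type u}
    [AddCommGroup M] [Module Rᵐᵒᵖ M] [AddCommGroup P₀] [Module Rᵐᵒᵖ P₀]
    [AddCommGroup P₁] [Module Rᵐᵒᵖ P₁] [AddCommGroup P₂] [Module Rᵐᵒᵖ P₂]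
    (hExt : ExtCommutesWithSumsOf Rᵐᵒᵖ 1 M R)
    (α₂ : P₂ →ₗ[Rᵐᵒᵖ] P₁) (α₁ : P₁ →ₗ[Rᵐᵒᵖ] P₀) (α₀ : P₀ →ₗ[Rᵐᵒᵖ] M)
    (hP : IsProjRes α₂ α₁ α₀)
    (hfg : (LinearMap.range α₂).FG) :
    ∃ (P₀' P₁' : ModuleCat.{u} Rᵐᵒᵖ)
      (α₂' : P₂ →ₗ[Rᵐᵒᵖ] P₁') (α₁' : P₁' →ₗ[Rᵐᵒᵖ] P₀') (α₀' : P₀' →ₗ[Rᵐᵒᵖ] M),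
      IsProjRes α₂' α₁' α₀' ∧ Module.Finite Rᵐᵒᵖ P₁' ∧
        ∃ e : LinearMap.range α₂ ≃ₗ[Rᵐᵒᵖ] LinearMap.range α₂',
          ∀ x : P₂, e (α₂.rangeRestrict x) = α₂'.rangeRestrict x := by
  exact hExt.exists_finite_projRes
    { MulOpposite.opAddEquiv with map_smul' := fun _ _ => rfl } hP hfg
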